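/- Let $(R,\mathfrak m)$ be a noetherian local integral domain, let $I$ and $J$ be ideals of $R$ with $J\neq 0$, and let $M$ be a faithful finitely generated $R$-module. Let $\tilde W(I,J)$ be the set of ideals $\mathfrak a$ of $R$ with $I^n\subseteq \mathfrak a+J$ for some integer $n\ge 0$. For an ideal $\mathfrak a$, let $\operatorname{depth}(\mathfrak a,M)$ be the supremum of the lengths of $M$-regular sequences contained in $\mathfrak a$ if $\mathfrak aM\neq M$, and $\infty$ if $\mathfrak aM=M$. Put $$\operatorname{depth}(I,J,M)=\inf\{\operatorname{depth}(\mathfrak a,M)\mid \mathfrak a\in\tilde W(I,J)\}.$$ Let $H^i_{I,J}$ be the $i$-th right derived functor of the functor $$\Gamma_{I,J}(N)=\{x\in N\mid I^nx\subseteq Jx \text{ for all sufficiently large } n\}$$ on $R$-modules. Write $\dim$ for the Krull dimension of the support, with $\dim 0=-\infty$. Call $M$ *$(I,J)$-Cohen–Macaulay* if $M=0$ or $\operatorname{depth}(I,J,M)=\dim M/JM$, and *Cohen–Macaulay* if $M=0$ or $\operatorname{depth}(\mathfrak m,M)=\dim M$. Suppose that $t=\operatorname{depth}(I,J,M)$ is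 finite and $\operatorname{Hom}_R\big(R/\mathfrak m,\,H^t_{I,J}(M)\big)\neq 0$. If $M$ is $(I,J)$-Cohen–Macaulay, then $M$ is not Cohen–Macaulay. -/

import Mathlib

universe u v

open CategoryTheory

/-- `W̃(I,J)`: the set of ideals `𝔞` with `I ^ n ≤ 𝔞 + J` for some `n`. -/
def pairIdeals {R : Type u} [CommRing R] (I J : Ideal R) : Set (Ideal R) :=
  {𝔞 | ∃ n : ℕ, I ^ n ≤ 𝔞 ⊔ J}

/-- The `(I,J)`-torsion submodule `Γ_{I,J}(M) = {x ∈ M | Iⁿ x ⊆ J x for n ≫ 1}`. As the powers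
of `I` decrease, "for `n ≫ 1`" is the same as "for some `n`". -/
def pairTorsion {R : Type u} [CommRing R] (I J : Ideal R)
    (M : Type v) [AddCommGroup M] [Module R M] : Submodule R M where
  carrier := {x | ∃ n : ℕ, ∀ a ∈ I ^ n, ∃ b ∈ J, a • x = b • x}
  zero_mem' := ⟨0, fun _ _ => ⟨0, J.zero_mem, by simp⟩⟩
  add_mem' := by
    rintro x y ⟨n, hn⟩ ⟨m, hm⟩
    refine ⟨n + m, fun c hc => ?_⟩
    rw [pow_add] at hc
    refine Submodule.mul_induction_on hc ?_ ?_
    · intro a ha b hb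
      obtain ⟨j, hj, hjx⟩ := hn a ha
      obtain ⟨k, hk, hky⟩ := hm b hb
      -- `(a - j) (b - k)` kills both `x` and `y`
      refine ⟨a * k + j * b - j * k, ?_, ?_⟩
      · exact J.sub_mem (J.add_mem (J.mul_mem_left _ hk) (J.mul_mem_right _ hj))
          (J.mul_mem_right _ hj)
      · have h1 : ((a - j) * (b - k)) • x = 0 := by
          rw [mul_comm, mul_smul, sub_smul a j x, hjx, sub_self, smul_zero]
        have h2 : ((a - j) * (b - k)) • y = 0 := by
          rw [mul_smul, sub_smul b k y, hky, sub_self, smul_zero]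
        have h3 : ((a - j) * (b - k)) • (x + y) = 0 := by
          rw [smul_add, h1, h2, add_zero]
        rw [← sub_eq_zero, ← sub_smul, ← h3]
        congr 1
        ring
    · rintro a b ⟨j, hj, hja⟩ ⟨k, hk, hkb⟩
      exact ⟨j + k, J.add_mem hj hk, by rw [add_smul, hja, hkb, ← add_smul]⟩
  smul_mem' := by
    rintro r x ⟨n, hn⟩
    refine ⟨n, fun a ha => ?_⟩
    obtain ⟨b, hb, h⟩ := hn a ha
    exact ⟨b, hb, by rw [smul_comm, h, smul_comm]⟩

/-- A linear map sends `(I,J)`-torsion elements to `(I,J)`-torsion elements. -/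
theorem pairTorsion_map_mem {R : Type u} [CommRing R] (I J : Ideal R)
    {M N : Type v} [AddCommGroup M] [Module R M] [AddCommGroup N] [Module R N] (f : M →ₗ[R] N)
    (x : M) (hx : x ∈ pairTorsion I J M) : f x ∈ pairTorsion I J N := by
  obtain ⟨n, hn⟩ := hx
  refine ⟨n, fun a ha => ?_⟩
  obtain ⟨b, hb, h⟩ := hn a ha
  exact ⟨b, hb, by rw [← map_smul, h, map_smul]⟩

/-- The `(I,J)`-torsion functor `Γ_{I,J}` on `R`-modules. -/
def pairTorsionFunctor {R : Type u} [CommRing R] (I J : Ideal R) :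
    ModuleCat.{v} R ⥤ ModuleCat.{v} R where
  obj M := ModuleCat.of R (pairTorsion I J M)
  map f := ModuleCat.ofHom (f.hom.restrict (pairTorsion_map_mem I J f.hom))

instance pairTorsionFunctor_additive {R : Type u} [CommRing R] (I J : Ideal R) :
    (pairTorsionFunctor.{u, v} I J).Additive where

/-- The local cohomology functor `H^i_{I,J}` with respect to the pair `(I,J)`: the `i`-th right
derived functor of `Γ_{I,J}`. -/
noncomputable def pairLocalCohomology {R : Type u} [CommRing R] [Small.{v} R] (I J : Ideal R)
    (i : ℕ) : ModuleCat.{v} R ⥤ ModuleCat.{v} R :=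
  (pairTorsionFunctor.{u, v} I J).rightDerived i

open Classical in
/-- `depth(𝔞, M)` for an ideal `𝔞` and a finite module `M`: the supremum of the lengths of
`M`-regular sequences in `𝔞` if `𝔞 M ≠ M`, and `∞` if `𝔞 M = M`. -/
noncomputable def idealDepth {R : Type u} [CommRing R] (𝔞 : Ideal R)
    (M : Type v) [AddCommGroup M] [Module R M] : ℕ∞ :=
  if 𝔞 • (⊤ : Submodule R M) = ⊤ then ⊤
  else ⨆ rs ∈ {rs : List R | (∀ r ∈ rs, r ∈ 𝔞) ∧ RingTheory.Sequence.IsRegular M rs},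
    (rs.length : ℕ∞)

/-- `depth(I, J, M)`: the infimum of `depth(𝔞, M)` over `𝔞 ∈ W̃(I,J)`. -/
noncomputable def pairDepth {R : Type u} [CommRing R] (I J : Ideal R)
    (M : Type v) [AddCommGroup M] [Module R M] : ℕ∞ :=
  ⨅ 𝔞 ∈ pairIdeals I J, idealDepth 𝔞 M

/-- `M` is `(I,J)`-Cohen–Macaulay: `M = 0`, or `depth(I,J,M) = dim M/JM`. -/
def IsPairCohenMacaulay {R : Type u} [CommRing R] (I J : Ideal R)
    (M : Type v) [AddCommGroup M] [Module R M] : Prop :=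
  Subsingleton M ∨
    (pairDepth I J M : WithBot ℕ∞) = Module.supportDim R (M ⧸ (J • (⊤ : Submodule R M)))

/-- A finite module `M` over a noetherian local ring `(R, 𝔪)` is Cohen–Macaulay: `M = 0`, or
`depth(𝔪, M) = dim M`. -/
def IsCohenMacaulayModule (R : Type u) [CommRing R] [IsLocalRing R]
    (M : Type v) [AddCommGroup M] [Module R M] : Prop :=
  Subsingleton M ∨
    (idealDepth (IsLocalRing.maximalIdeal R) M : WithBot ℕ∞) = Module.supportDim R M

/-! Since `M` is faithful over a domain, its support is all of Spec `R`; as `J ≠ 0`, the zero prime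
lies outside `V(J)`, so `dim M > dim M/JM = t`. If `M` were Cohen–Macaulay, `depth(𝔪, M)` would be
at least `t + 1`, and it remains to show that `Hom(R/𝔪, H^t_{I,J}(M))` then vanishes
(`subsingleton_hom_pairLocalCohomology`).

In an injective resolution of `M`, a socle class of `H^t_{I,J}(M)` is a torsion cocycle `z` with
`𝔪z` inside the boundaries of torsion elements. One `𝔞 ∈ W̃(I,J)` kills `z` and finitely many
witnesses. As `depth(𝔞, M) ≥ t`, Ext in degree `t - 1` vanishes on submodules of `(R/𝔞)^s`, and
`exists_smul_sub_eq_zero` changes `z` by a torsion boundary so that `𝔪` kills it. Then `Ext^t(R/𝔪,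
M) = 0` makes it the boundary of an element killed by `𝔪`, which is torsion because `𝔪 ∈ W̃(I,J)`.
-/

/-! ### Torsion elements and the ideals of `W̃(I,J)` -/

/-- The equation `a • x = b • x` says that `a - b` annihilates `x`, so the annihilator of `x` serves
as `𝔞`. -/
theorem mem_pairTorsion_iff_exists_mem_pairIdeals {R : Type u} [CommRing R] {I J : Ideal R}
    {M : Type v} [AddCommGroup M] [Module R M] {x : M} :
    x ∈ pairTorsion I J M ↔ ∃ 𝔞 ∈ pairIdeals I J, ∀ r ∈ 𝔞, r • x = 0 := by
  constructor
  · rintro ⟨n, hn⟩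
    refine ⟨(R ∙ x).annihilator, ⟨n, fun a ha => ?_⟩, fun r hr => ?_⟩
    · obtain ⟨b, hb, h⟩ := hn a ha
      rw [← sub_add_cancel a b]
      refine Submodule.add_mem_sup ?_ hb
      rw [Submodule.mem_annihilator_span_singleton, sub_smul, h, sub_self]
    · rwa [Submodule.mem_annihilator_span_singleton] at hr
  · rintro ⟨𝔞, ⟨n, hn⟩, h⟩
    refine ⟨n, fun a ha => ?_⟩
    obtain ⟨c, hc, b, hb, rfl⟩ := Submodule.mem_sup.1 (hn ha)
    exact ⟨b, hb, by rw [add_smul, h c hc, zero_add]⟩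

theorem mul_mem_pairIdeals {R : Type u} [CommRing R] {I J 𝔞 𝔟 : Ideal R}
    (ha : 𝔞 ∈ pairIdeals I J) (hb : 𝔟 ∈ pairIdeals I J) : 𝔞 * 𝔟 ∈ pairIdeals I J := by
  obtain ⟨n, hn⟩ := ha
  obtain ⟨m, hm⟩ := hb
  refine ⟨n + m, ?_⟩
  rw [pow_add]
  refine (Ideal.mul_mono hn hm).trans (Ideal.mul_le.2 fun x hx y hy => ?_)
  obtain ⟨a, ha, j, hj, rfl⟩ := Submodule.mem_sup.1 hx
  obtain ⟨b, hb, k, hk, rfl⟩ := Submodule.mem_sup.1 hy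
  refine Submodule.mem_sup.2 ⟨a * b, Ideal.mul_mem_mul ha hb, a * k + j * (b + k),
    J.add_mem (J.mul_mem_left _ hk) (J.mul_mem_right _ hj), by ring⟩

theorem exists_mem_pairIdeals_forall_smul_eq_zero {R : Type u} [CommRing R] {I J : Ideal R}
    {M : Type v} [AddCommGroup M] [Module R M] {ι : Type*} [Finite ι] (w : ι → M)
    (hw : ∀ i, w i ∈ pairTorsion I J M) :
    ∃ 𝔞 ∈ pairIdeals I J, ∀ r ∈ 𝔞, ∀ i, r • w i = 0 := by
  classical
  have := Fintype.ofFinite ι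
  choose 𝔟 h𝔟 h using fun i => mem_pairTorsion_iff_exists_mem_pairIdeals.1 (hw i)
  refine ⟨∏ i, 𝔟 i, ?_, fun r hr i => h i r ?_⟩
  · refine Finset.prod_induction 𝔟 (· ∈ pairIdeals I J) (fun _ _ => mul_mem_pairIdeals)
      ⟨0, ?_⟩ fun i _ => h𝔟 i
    rw [Ideal.one_eq_top]; exact le_top.trans le_sup_left
  · exact Ideal.prod_le_inf.trans (Finset.inf_le (Finset.mem_univ i)) hr

/-- If an ideal `𝔟` sends the class of `z` into the image of `β`, the witnesses being killed by
`𝔞`, then `z` can be corrected by some `β y`, with `y` killed by `𝔞`, so as to be killed by `𝔟`. -/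
theorem exists_smul_sub_eq_zero {R : Type u} [CommRing R] {A B C : Type*}
    [AddCommGroup A] [AddCommGroup B] [AddCommGroup C] [Module R A] [Module R B] [Module R C]
    (α : A →ₗ[R] B) (β : B →ₗ[R] C) (hβα : β ∘ₗ α = 0) (hA : Module.Baer R A)
    (hB : Module.Baer R B) (𝔞 𝔟 : Ideal R) {ι : Type*} [Fintype ι] (r : ι → R)
    (hr : Ideal.span (Set.range r) = 𝔟) (w : ι → B) (z : C)
    (hw : ∀ a ∈ 𝔞, ∀ i, a • w i = 0) (hrw : ∀ i, β (w i) = r i • z)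
    (hz : ∀ a ∈ 𝔞, a • z = 0)
    (hexact : ∀ (K : Submodule R (ι → R ⧸ 𝔞)) (f : K →ₗ[R] B), β ∘ₗ f = 0 →
      ∃ g : K →ₗ[R] A, α ∘ₗ g = f) :
    ∃ y : B, (∀ a ∈ 𝔞, a • y = 0) ∧ ∀ b ∈ 𝔟, b • (z - β y) = 0 := by
  classical
  let φ : (ι → R ⧸ 𝔞) →ₗ[R] R ⧸ 𝔞 := ∑ i, r i • LinearMap.proj i
  let e (i : ι) : R ⧸ 𝔞 →ₗ[R] B :=
    Submodule.liftQ 𝔞 (LinearMap.toSpanSingleton R B (w i)) fun a ha => by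
      simpa using hw a ha i
  let ζ : R ⧸ 𝔞 →ₗ[R] C :=
    Submodule.liftQ 𝔞 (LinearMap.toSpanSingleton R C z) fun a ha => by simpa using hz a ha
  let W : (ι → R ⧸ 𝔞) →ₗ[R] B := ∑ i, e i ∘ₗ LinearMap.proj i
  have he (i : ι) : β ∘ₗ e i = r i • ζ := by
    refine LinearMap.ext fun x => ?_
    obtain ⟨c, rfl⟩ := Submodule.Quotient.mk_surjective _ x
    change β (c • w i) = r i • c • z
    rw [map_smul, hrw, smul_comm]
  have hW : β ∘ₗ W = ζ ∘ₗ φ := by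
    refine LinearMap.ext fun c => ?_
    simp only [W, φ, LinearMap.comp_apply, LinearMap.sum_apply, map_sum, LinearMap.smul_apply,
      map_smul]
    exact Finset.sum_congr rfl fun i _ => LinearMap.congr_fun (he i) (c i)
  -- On `ker φ` the map `W` is a cocycle, hence of the form `α ∘ g`; injectivity of `A` extends `g`
  -- to `G`.
  obtain ⟨g, hg⟩ := hexact (LinearMap.ker φ) (W ∘ₗ (LinearMap.ker φ).subtype) (by
    rw [← LinearMap.comp_assoc, hW]
    ext c
    simp)
  obtain ⟨G, hG⟩ := hA.extension_property (LinearMap.ker φ).subtype Subtype.val_injective g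
  have hker : LinearMap.ker φ ≤ LinearMap.ker (W - α ∘ₗ G) := by
    intro c hc
    have h1 := LinearMap.congr_fun hg ⟨c, hc⟩
    have h2 := LinearMap.congr_fun hG ⟨c, hc⟩
    simp only [LinearMap.comp_apply, Submodule.subtype_apply] at h1 h2
    simp [h2, h1]
  -- `W - α ∘ G` factors through the image of `φ` in `R ⧸ 𝔞`, and injectivity of `B` extends it to
  -- `H` on `R ⧸ 𝔞`. The correction is `y = H 1`: `r i • y` differs from `w i` by an element of the
  -- image of `α`, which `β` kills.
  obtain ⟨H, hH⟩ := hB.extension_property ((LinearMap.ker φ).liftQ φ le_rfl)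
    (LinearMap.ker_eq_bot.1 (Submodule.ker_liftQ_eq_bot _ _ _ le_rfl))
    ((LinearMap.ker φ).liftQ (W - α ∘ₗ G) hker)
  have hHφ (c : ι → R ⧸ 𝔞) : H (φ c) = W c - α (G c) := by
    simpa using LinearMap.congr_fun hH (Submodule.Quotient.mk c)
  refine ⟨H (Submodule.Quotient.mk 1), fun a ha => ?_, fun b hb => ?_⟩
  · rw [← map_smul, ← Submodule.Quotient.mk_smul, smul_eq_mul, mul_one,
      (Submodule.Quotient.mk_eq_zero 𝔞).2 ha, map_zero]
  · rw [← hr] at hb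
    induction hb using Submodule.span_induction with
    | mem b hb =>
      obtain ⟨i, rfl⟩ := hb
      have h1 := hHφ (Pi.single i (Submodule.Quotient.mk 1))
      have h2 : φ (Pi.single i (Submodule.Quotient.mk 1)) = r i • Submodule.Quotient.mk 1 := by
        simp [φ, LinearMap.sum_apply, Pi.single_apply]
      have h3 : W (Pi.single i (Submodule.Quotient.mk 1)) = w i := by
        simp only [W, LinearMap.sum_apply, LinearMap.comp_apply, LinearMap.proj_apply]
        rw [Finset.sum_eq_single i]
        · rw [Pi.single_eq_same]
          exact one_smul R (w i)
        · intro j _ hj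
          simp [hj]
        · simp
      rw [h2, h3, map_smul] at h1
      have h4 (a : A) : β (α a) = 0 := LinearMap.congr_fun hβα a
      rw [smul_sub, ← map_smul, h1, map_sub, h4, hrw, sub_zero, sub_self]
    | zero => simp
    | add x y _ _ hx hy => rw [add_smul, hx, hy, add_zero]
    | smul a x _ hx => rw [smul_assoc, hx, smul_zero]

/-! ### Dimension of the support -/

/-- A chain of primes in the support of `M/JM` lies in `V(J)`, so the zero prime can be put below
it. -/
theorem natCast_succ_le_supportDim {R : Type u} [CommRing R] [IsDomain R]
    {M : Type v} [AddCommGroup M] [Module R M] [Module.Finite R M]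
    [FaithfulSMul R M] {J : Ideal R} (hJ : J ≠ ⊥) {t : ℕ}
    (ht : (t : WithBot ℕ∞) ≤ Module.supportDim R (M ⧸ (J • (⊤ : Submodule R M)))) :
    ((t + 1 : ℕ) : WithBot ℕ∞) ≤ Module.supportDim R M := by
  have hsupp (p : PrimeSpectrum R) : p ∈ Module.support R M := by
    rw [Module.mem_support_iff_of_finite, Module.annihilator_eq_bot.2 ‹_›]
    exact bot_le
  obtain ⟨l, hl⟩ := Order.le_krullDim_iff.1 ht
  let l' : LTSeries (Module.support R M) := l.map (fun p => ⟨p.1, hsupp p.1⟩) fun _ _ h => h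
  have hhead : l.head.1 ∈ Module.support R M ∩ PrimeSpectrum.zeroLocus J :=
    Module.support_quotient (M := M) J ▸ l.head.2
  have hlt : (⟨⊥, hsupp ⊥⟩ : Module.support R M) < l'.head := by
    change (⊥ : PrimeSpectrum R) < l.head.1
    refine bot_lt_iff_ne_bot.2 fun h => hJ (le_bot_iff.1 ?_)
    have := hhead.2
    rw [h] at this
    exact this
  exact Order.le_krullDim_iff.2 ⟨l'.cons _ hlt, (l'.cons_length _ hlt).trans (congrArg (· + 1) hl)⟩

/-! ### Vanishing of Ext and lifting of cocycles -/

theorem subsingleton_ext_of_le_idealDepth {R : Type u} [CommRing R] [IsNoetherianRing R]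
    [IsLocalRing R] [Small.{v} R] {M : Type v} [AddCommGroup M] [Module R M] [Module.Finite R M]
    [Nontrivial M] {𝔞 : Ideal R} (h𝔞 : 𝔞 ≤ IsLocalRing.maximalIdeal R) {n : ℕ}
    (hn : (n + 1 : ℕ) ≤ idealDepth 𝔞 M) (N : ModuleCat.{v} R) [Module.Finite R N]
    (hN : 𝔞 ≤ Module.annihilator R N) :
    Subsingleton (Abelian.Ext N (ModuleCat.of R M) n) := by
  have hlt : 𝔞 • (⊤ : Submodule R M) ≠ ⊤ := fun h =>
    (Submodule.top_ne_ideal_smul_of_le_jacobson_annihilator (M := M)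
      (h𝔞.trans (IsLocalRing.maximalIdeal_le_jacobson _))) h.symm
  rw [idealDepth, if_neg hlt] at hn
  obtain ⟨rs, ⟨hmem, hreg⟩, hlen⟩ : ∃ rs : List R,
      ((∀ r ∈ rs, r ∈ 𝔞) ∧ RingTheory.Sequence.IsRegular M rs) ∧ n < rs.length := by
    by_contra! h
    have : (⨆ rs ∈ {rs : List R | (∀ r ∈ rs, r ∈ 𝔞) ∧ RingTheory.Sequence.IsRegular M rs},
      (rs.length : ℕ∞)) ≤ n := iSup₂_le fun rs hrs => by exact_mod_cast h rs hrs
    have := hn.trans this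
    norm_cast at this
    omega
  refine ModuleCat.subsingleton_ext_of_exists_isRegular 𝔞 N ?_ (ModuleCat.of R M) hlt.lt_top rs
    hmem hreg n hlen
  rw [Module.support_eq_zeroLocus]
  exact PrimeSpectrum.zeroLocus_anti_mono_ideal hN

/-- `Ext^n(X, M)` is the cohomology of `Hom(X, P)`. `Shrink` only moves `X` to the universe of `M`.
-/
theorem exists_lift_of_subsingleton_ext {R : Type u} [CommRing R] [Small.{v} R]
    {M : ModuleCat.{v} R} (P : InjectiveResolution M) (n : ℕ) {X : Type*}
    [AddCommGroup X] [Module R X] [Small.{v} X]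
    (hX : Subsingleton (Abelian.Ext (ModuleCat.of R (Shrink.{v} X)) M n))
    (f : X →ₗ[R] P.cocomplex.X n) (hf : (P.cocomplex.d n (n + 1)).hom ∘ₗ f = 0) :
    ∃ g : X →ₗ[R] P.cocomplex.X ((ComplexShape.up ℕ).prev n),
      (P.cocomplex.d ((ComplexShape.up ℕ).prev n) n).hom ∘ₗ g = f := by
  let e := Shrink.linearEquiv.{v} R X
  let f' : ModuleCat.of R (Shrink.{v} X) ⟶ P.cocomplex.X n := ModuleCat.ofHom (f ∘ₗ e.toLinearMap)
  have hf' : f' ≫ P.cocomplex.d n (n + 1) = 0 := by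
    ext x
    exact LinearMap.congr_fun hf (e x)
  -- In degree `0`, `prev 0 = 0` and the differential from `0` to `0` is zero, so the claim is `f =
  -- 0`; it holds as `f` factors through `M`.
  cases n with
  | zero =>
    have : Subsingleton (ModuleCat.of R (Shrink.{v} X) ⟶ M) :=
      Abelian.Ext.addEquiv₀.symm.subsingleton
    refine ⟨0, ?_⟩
    have h0 : f' = 0 := by
      obtain ⟨k, hk⟩ := Limits.KernelFork.IsLimit.lift' P.isLimitKernelFork f' hf'
      rw [← hk, show k = 0 from this.elim k 0, Limits.zero_comp]
    ext x
    have := ConcreteCategory.congr_hom h0 (e.symm x)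
    simpa [f'] using this.symm
  | succ p =>
    obtain ⟨g, hg⟩ := (P.extMk_eq_zero_iff f' (p + 2) rfl hf' p rfl).1 (Subsingleton.elim _ _)
    have hprev : (ComplexShape.up ℕ).prev (p + 1) = p := CochainComplex.prev_nat_succ p
    rw [hprev]
    refine ⟨g.hom ∘ₗ e.symm.toLinearMap, ?_⟩
    ext x
    have := ConcreteCategory.congr_hom hg (e.symm x)
    simpa [f'] using this

/-! ### Socle elements of local cohomology, represented by cocycles -/

theorem exists_cycle_of_nontrivial_hom {R : Type u} [CommRing R] (𝔪 : Ideal R)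
    (S : ShortComplex (ModuleCat.{v} R)) (h : Nontrivial ((R ⧸ 𝔪) →ₗ[R] S.homology)) :
    ∃ z : S.X₂, S.g z = 0 ∧ (∀ r ∈ 𝔪, ∃ w, S.f w = r • z) ∧ ¬ ∃ w, S.f w = z := by
  obtain ⟨f, hf⟩ := exists_ne (0 : (R ⧸ 𝔪) →ₗ[R] S.homology)
  let e : S.homology ≃ₗ[R] S.g.hom.ker ⧸ LinearMap.range S.moduleCatToCycles :=
    S.moduleCatHomologyIso.toLinearEquiv
  obtain ⟨z, hz⟩ := Submodule.Quotient.mk_surjective _ (e (f (Submodule.Quotient.mk 1)))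
  refine ⟨z.1, z.2, fun r hr => ?_, ?_⟩
  · have h1 : e (f (Submodule.Quotient.mk (r • 1))) = 0 := by
      rw [(Submodule.Quotient.mk_eq_zero 𝔪).2 (by simpa using hr), map_zero, map_zero]
    rw [Submodule.Quotient.mk_smul, map_smul, map_smul, ← hz, ← Submodule.Quotient.mk_smul,
      Submodule.Quotient.mk_eq_zero] at h1
    obtain ⟨w, hw⟩ := h1
    exact ⟨w, congrArg Subtype.val hw⟩
  · rintro ⟨w, hw⟩
    apply hf
    refine Submodule.linearMap_qext _ (LinearMap.ext_ring ?_)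
    refine e.injective (hz.symm.trans ?_)
    rw [LinearMap.zero_comp, LinearMap.zero_apply, map_zero]
    exact (Submodule.Quotient.mk_eq_zero _).2 ⟨w, Subtype.ext hw⟩

/-- If `I = R`, then `𝔞 + J = R` for every `𝔞 ∈ W̃(I,J)`, so `𝔞 = R` by locality and all depths are
infinite. Hence `I ≤ 𝔪`. -/
theorem maximalIdeal_mem_pairIdeals {R : Type u} [CommRing R] [IsLocalRing R]
    {M : Type v} [AddCommGroup M] [Module R M] {I J : Ideal R}
    (hJ : J ≤ IsLocalRing.maximalIdeal R) (hdepth : pairDepth I J M ≠ ⊤) :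
    IsLocalRing.maximalIdeal R ∈ pairIdeals I J := by
  refine ⟨1, ?_⟩
  rw [pow_one, sup_eq_left.2 hJ]
  refine IsLocalRing.le_maximalIdeal fun hI => hdepth ?_
  refine iInf₂_eq_top.2 fun 𝔞 ⟨n, hn⟩ => ?_
  have h𝔞 : 𝔞 = ⊤ := by
    by_contra h
    refine (IsLocalRing.maximalIdeal.isMaximal R).ne_top (top_le_iff.1 ?_)
    rw [hI, Ideal.top_pow] at hn
    exact hn.trans (sup_le (IsLocalRing.le_maximalIdeal h) hJ)
  rw [idealDepth, if_pos]
  rw [h𝔞, Submodule.top_smul]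

theorem exists_cocycle_of_nontrivial_hom_pairLocalCohomology {R : Type u} [CommRing R]
    [Small.{v} R] {M : ModuleCat.{v} R} (P : InjectiveResolution M) (I J 𝔪 : Ideal R) (t : ℕ)
    (h : Nontrivial ((R ⧸ 𝔪) →ₗ[R] ((pairLocalCohomology I J t).obj M))) :
    ∃ z ∈ pairTorsion I J (P.cocomplex.X t), (P.cocomplex.d t (t + 1)).hom z = 0 ∧
      (∀ r ∈ 𝔪, ∃ w ∈ pairTorsion I J (P.cocomplex.X ((ComplexShape.up ℕ).prev t)),
        (P.cocomplex.d ((ComplexShape.up ℕ).prev t) t).hom w = r • z) ∧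
      ∀ w ∈ pairTorsion I J (P.cocomplex.X ((ComplexShape.up ℕ).prev t)),
        (P.cocomplex.d ((ComplexShape.up ℕ).prev t) t).hom w ≠ z := by
  let S := (((pairTorsionFunctor.{u, v} I J).mapHomologicalComplex (ComplexShape.up ℕ)).obj
    P.cocomplex).sc t
  let iso : (pairLocalCohomology I J t).obj M ≅ S.homology :=
    P.isoRightDerivedObj (pairTorsionFunctor.{u, v} I J) t
  have hnt : Nontrivial ((R ⧸ 𝔪) →ₗ[R] S.homology) :=
    (LinearEquiv.congrRight iso.toLinearEquiv).symm.toEquiv.nontrivial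
  obtain ⟨z, hz, hmz, hz'⟩ := exists_cycle_of_nontrivial_hom _ S hnt
  refine ⟨Subtype.val z, Subtype.property z, ?_, fun r hr => ?_, fun w hw h => ?_⟩
  · have hnext : (ComplexShape.up ℕ).next t = t + 1 := CochainComplex.next ℕ t
    have h := congrArg Subtype.val hz
    change (P.cocomplex.d t ((ComplexShape.up ℕ).next t)).hom (Subtype.val z) = 0 at h
    rwa [hnext] at h
  · obtain ⟨w, hw⟩ := hmz r hr
    exact ⟨Subtype.val w, Subtype.property w, congrArg Subtype.val hw⟩
  · exact hz' ⟨⟨w, hw⟩, Subtype.ext h⟩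

theorem exists_smul_eq_zero_of_subsingleton_ext {R : Type u} [CommRing R] [Small.{v} R]
    {M : ModuleCat.{v} R} (P : InjectiveResolution M) (n : ℕ) (𝔪 : Ideal R)
    (hext : Subsingleton (Abelian.Ext (ModuleCat.of R (Shrink.{v} (R ⧸ 𝔪))) M n))
    (x : P.cocomplex.X n) (hx : ∀ r ∈ 𝔪, r • x = 0)
    (hdx : (P.cocomplex.d n (n + 1)).hom x = 0) :
    ∃ v : P.cocomplex.X ((ComplexShape.up ℕ).prev n), (∀ r ∈ 𝔪, r • v = 0) ∧
      (P.cocomplex.d ((ComplexShape.up ℕ).prev n) n).hom v = x := by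
  obtain ⟨g, hg⟩ := exists_lift_of_subsingleton_ext P n hext
    (Submodule.liftQ 𝔪 (LinearMap.toSpanSingleton R _ x) fun a ha => hx a ha)
    (Submodule.linearMap_qext _ (LinearMap.ext_ring (by
      change (P.cocomplex.d n (n + 1)).hom ((1 : R) • x) = 0
      rw [one_smul, hdx])))
  refine ⟨g (Submodule.Quotient.mk 1), fun r hr => ?_,
    (LinearMap.congr_fun hg _).trans (one_smul R x)⟩
  rw [← map_smul, ← Submodule.Quotient.mk_smul, smul_eq_mul, mul_one,
    (Submodule.Quotient.mk_eq_zero _).2 hr, map_zero]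

theorem le_annihilator_pi_quotient_submodule {R : Type u} [CommRing R] (𝔞 : Ideal R) {ι : Type*}
    (K : Submodule R (ι → R ⧸ 𝔞)) : 𝔞 ≤ Module.annihilator R K := by
  intro a ha
  rw [Module.mem_annihilator]
  refine fun k => Subtype.ext (funext fun i => ?_)
  change a • (k : ι → R ⧸ 𝔞) i = 0
  obtain ⟨c, hc⟩ := Submodule.Quotient.mk_surjective _ ((k : ι → R ⧸ 𝔞) i)
  rw [← hc, ← Submodule.Quotient.mk_smul, Submodule.Quotient.mk_eq_zero]
  exact Ideal.mul_mem_right _ _ ha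

theorem subsingleton_ext_shrink_of_le_idealDepth {R : Type u} [CommRing R] [IsNoetherianRing R]
    [IsLocalRing R] [Small.{v} R] {M : Type v} [AddCommGroup M] [Module R M] [Module.Finite R M]
    [Nontrivial M] {𝔞 : Ideal R} (h𝔞 : 𝔞 ≤ IsLocalRing.maximalIdeal R) {n : ℕ}
    (hn : (n + 1 : ℕ) ≤ idealDepth 𝔞 M) (X : Type*) [AddCommGroup X] [Module R X] [Small.{v} X]
    [Module.Finite R X] (hX : 𝔞 ≤ Module.annihilator R X) :
    Subsingleton (Abelian.Ext (ModuleCat.of R (Shrink.{v} X)) (ModuleCat.of R M) n) := by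
  have : Module.Finite R (Shrink.{v} X) := Module.Finite.equiv (Shrink.linearEquiv R X).symm
  exact subsingleton_ext_of_le_idealDepth h𝔞 hn (ModuleCat.of R (Shrink.{v} X))
    (by rwa [(Shrink.linearEquiv R X).annihilator_eq])

/-! ### Vanishing of the socle, and the theorem -/

theorem subsingleton_hom_pairLocalCohomology {R : Type u} [CommRing R] [IsNoetherianRing R]
    [IsLocalRing R] [Small.{v} R] {M : Type v} [AddCommGroup M] [Module R M] [Module.Finite R M]
    [Nontrivial M] {I J : Ideal R} {t : ℕ}
    (h𝔪 : IsLocalRing.maximalIdeal R ∈ pairIdeals I J) (ht : t ≤ pairDepth I J M)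
    (hdepth : (t + 1 : ℕ) ≤ idealDepth (IsLocalRing.maximalIdeal R) M) :
    Subsingleton ((R ⧸ IsLocalRing.maximalIdeal R) →ₗ[R]
      ((pairLocalCohomology I J t).obj (ModuleCat.of R M))) := by
  by_contra hnot
  rw [not_subsingleton_iff_nontrivial] at hnot
  let P : InjectiveResolution (ModuleCat.of R M) := InjectiveResolution.of (ModuleCat.of R M)
  have hBaer (n : ℕ) : Module.Baer R (P.cocomplex.X n) :=
    have : Injective (ModuleCat.of R (P.cocomplex.X n)) := P.injective n
    Module.Baer.of_injective (Module.injective_module_of_injective_object R (P.cocomplex.X n))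
  obtain ⟨z, hz, hdz, hmz, hz'⟩ :=
    exists_cocycle_of_nontrivial_hom_pairLocalCohomology P I J _ t hnot
  clear_value P
  -- it suffices to move `z` by the boundary of a torsion element into the socle
  suffices h : ∃ y ∈ pairTorsion I J (P.cocomplex.X ((ComplexShape.up ℕ).prev t)),
      ∀ r ∈ IsLocalRing.maximalIdeal R,
        r • (z - (P.cocomplex.d ((ComplexShape.up ℕ).prev t) t).hom y) = 0 by
    obtain ⟨y, hy, hyz⟩ := h
    obtain ⟨v, hv, hvz⟩ := exists_smul_eq_zero_of_subsingleton_ext P t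
      (IsLocalRing.maximalIdeal R)
      (subsingleton_ext_shrink_of_le_idealDepth le_rfl hdepth _ Ideal.annihilator_quotient.ge)
      _ hyz (by
        rw [map_sub, hdz, zero_sub, neg_eq_zero]
        exact ConcreteCategory.congr_hom (P.cocomplex.d_comp_d _ t (t + 1)) y)
    exact hz' (y + v)
      (add_mem hy (mem_pairTorsion_iff_exists_mem_pairIdeals.2 ⟨_, h𝔪, hv⟩))
      (by rw [map_add, hvz, add_sub_cancel])
  obtain rfl | ⟨n, rfl⟩ : t = 0 ∨ ∃ n, t = n + 1 := by cases t <;> simp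
  -- In degree `0` the incoming differential is zero, so `𝔪` already kills `z`.
  · refine ⟨0, zero_mem _, fun r hr => ?_⟩
    obtain ⟨w, -, hw⟩ := hmz r hr
    rw [map_zero, sub_zero, ← hw, P.cocomplex.shape _ 0 (by simp)]
    rfl
  rw [show (ComplexShape.up ℕ).prev (n + 1) = n from CochainComplex.prev_nat_succ n] at *
  obtain ⟨s, hs⟩ := IsNoetherian.noetherian (IsLocalRing.maximalIdeal R)
  have hsm (i : s) : (i : R) ∈ IsLocalRing.maximalIdeal R := hs ▸ Ideal.subset_span i.2
  choose w hwmem hw using fun i : s => hmz i (hsm i)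
  obtain ⟨𝔟, h𝔟, hz𝔟⟩ := mem_pairTorsion_iff_exists_mem_pairIdeals.1 hz
  obtain ⟨𝔠, h𝔠, hw𝔠⟩ := exists_mem_pairIdeals_forall_smul_eq_zero w hwmem
  have h𝔞 : 𝔟 * 𝔠 ∈ pairIdeals I J := mul_mem_pairIdeals h𝔟 h𝔠
  -- Depth bounds Ext only for a proper ideal; were the product `R`, then `z = 0` would be a
  -- boundary.
  have hle : 𝔟 * 𝔠 ≤ IsLocalRing.maximalIdeal R := by
    refine IsLocalRing.le_maximalIdeal fun htop => hz' 0 (zero_mem _) ?_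
    have h1 : (1 : R) ∈ 𝔟 := Ideal.mul_le_left (by rw [htop]; exact Submodule.mem_top : (1 : R) ∈ 𝔟 * 𝔠)
    rw [map_zero, ← one_smul R z, hz𝔟 1 h1]
  obtain ⟨y, hy, hyz⟩ := exists_smul_sub_eq_zero
    (P.cocomplex.d ((ComplexShape.up ℕ).prev n) n).hom (P.cocomplex.d n (n + 1)).hom
    (by rw [← ModuleCat.hom_comp, P.cocomplex.d_comp_d, ModuleCat.hom_zero]) (hBaer _) (hBaer _)
    (𝔟 * 𝔠) (IsLocalRing.maximalIdeal R) (fun i : s => (i : R))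
    ((congrArg Ideal.span Subtype.range_coe).trans hs) w z
    (fun a ha => hw𝔠 a (Ideal.mul_le_right ha)) hw (fun a ha => hz𝔟 a (Ideal.mul_le_left ha))
    (fun K f hf => exists_lift_of_subsingleton_ext P n
      (subsingleton_ext_shrink_of_le_idealDepth hle (ht.trans (iInf₂_le _ h𝔞)) K
        (le_annihilator_pi_quotient_submodule _ K)) f hf)
  exact ⟨y, mem_pairTorsion_iff_exists_mem_pairIdeals.2 ⟨_, h𝔞, hy⟩, hyz⟩

theorem proposition4p8 {R : Type u} [CommRing R] [IsNoetherianRing R] [IsLocalRing R] [IsDomain R]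
    [Small.{v} R] {M : Type v} [AddCommGroup M] [Module R M] [Module.Finite R M]
    [FaithfulSMul R M] (I J : Ideal R) (hJ : J ≠ ⊥) (t : ℕ) (ht : pairDepth I J M = t)
    (hHom : Nontrivial ((R ⧸ IsLocalRing.maximalIdeal R) →ₗ[R]
      ((pairLocalCohomology I J t).obj (ModuleCat.of R M))))
    (hCM : IsPairCohenMacaulay I J M) :
    ¬ IsCohenMacaulayModule R M := by
  have hM : Nontrivial M := by
    by_contra h
    rw [not_nontrivial_iff_subsingleton] at h
    exact zero_ne_one (FaithfulSMul.eq_of_smul_eq_smul (M := R) (α := M)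
      fun m => Subsingleton.elim ((0 : R) • m) ((1 : R) • m))
  have hdim : ((t : ℕ∞) : WithBot ℕ∞) = Module.supportDim R (M ⧸ (J • (⊤ : Submodule R M))) :=
    ht ▸ hCM.resolve_left (not_subsingleton M)
  have hJ𝔪 : J ≤ IsLocalRing.maximalIdeal R := by
    refine IsLocalRing.le_maximalIdeal fun h => ?_
    have : Subsingleton (M ⧸ (J • (⊤ : Submodule R M))) :=
      Submodule.Quotient.subsingleton_iff.2 (by rw [h, Submodule.top_smul])
    rw [Module.supportDim_eq_bot_of_subsingleton] at hdim
    exact WithBot.coe_ne_bot hdim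
  rintro (h | h)
  · exact not_subsingleton M h
  have hlt : ((t + 1 : ℕ) : WithBot ℕ∞) ≤ idealDepth (IsLocalRing.maximalIdeal R) M :=
    (natCast_succ_le_supportDim hJ hdim.le).trans h.ge
  refine not_subsingleton_iff_nontrivial.2 hHom (subsingleton_hom_pairLocalCohomology
    (maximalIdeal_mem_pairIdeals (M := M) hJ𝔪 (by simp [ht])) ht.ge ?_)
  exact_mod_cast hlt
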